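/- Let $K$ be an algebraically closed field of characteristic zero, $d\ge 0$, and let $A\subset\mathbb Z^d$ be a finite set that generates $\mathbb Z^d$ as a group and whose cone $\mathbb R_{\ge0}A$ is strongly convex. Let $\mathcal F$ be the set of facets of $\mathbb R_{\ge 0}A$ and, for $\sigma\in\mathcal F$, let $F_\sigma$ be its primitive integral support function, i.e. the linear form on $\mathbb R^d$ with $F_\sigma\ge 0$ on $\mathbb R_{\ge0}A$, $F_\sigma=0$ on $\sigma$ and $F_\sigma(\mathbb Z^d)=\mathbb Z$. A subset $S\subseteq\mathbb Z^d$ is an $\mathbb NA$-set if $S+\mathbb NA\subseteq S$; it is finitely generated if $S=G+\mathbb NA$ for a finite set $G$; it is scored if $S=\bigcap_{\sigma\in\mathcal F}\{a\in\mathbb Z^d: F_\sigma(a)\in F_\sigma(S)\}$. Let $S_c$ be a finitely generated scored $\mathbb NA$-set, let $b_1,\dots,b_m\in S_c$, let $\tau_1,\dots,\tau_m$ be faces of $\mathbb R_{\ge0}A$, and let $$S=S_c\setminus\bigcup_{i=1}^m\bigl(b_i+\mathbb Z(A\cap\tau_i)\bigr),$$ where this expression is irredundant (no coset can be omitted), $F_\sigma(S)=F_\sigma(S_c)$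 for all $\sigma\in\mathcal F$, and $S$ is an $\mathbb NA$-set. Put $\tilde{\mathcal F}=\mathcal F\cup\{\tau_1,\dots,\tau_m\}$. Let $\mathcal B$ be the set of families $(b_\tau)_{\tau\in\tilde{\mathcal F}}$ with $b_\tau\in(K\tau\cap\mathbb Z^d)/\mathbb Z(A\cap\tau)$ for every $\tau\in\tilde{\mathcal F}$ such that, for all $i$ and all $\tau\in\tilde{\mathcal F}$ with $\tau\supseteq\tau_i$, there is a $j$ with $\tau_j=\tau$ and $b_i+b_{\tau_i}\equiv b_j+b_{\tau_j}\pmod{\mathbb Z(A\cap\tau)}$; here $K\tau$ is the $K$-span of $A\cap\tau$. Assume $\mathcal B\neq\emptyset$, fix any $(b_\tau)\in\mathcal B$, and put $$\omega(S)=\{a\in\mathbb Z^d:\ -a-b_\tau\notin S+\mathbb Z(A\cap\tau)\ \text{ for each }\tau\in\tilde{\mathcal F}\}.$$ Let $D(\mathbb Z^d)$ be the ring of $K$-linear differential operators (in the sense of Grothendieck) of the Laurent polynomial ring $K[\mathbb Z^d]=K[t_1^{\pm1},\dots,t_d^{\pm1}]$ and, for $T\subseteq\mathbb Z^d$, put $K[T]=\bigoplus_{a\in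 T}Kt^a$ and $D(T)=\{P\in D(\mathbb Z^d): P(K[T])\subseteq K[T]\}$. Every $P\in D(\mathbb Z^d)$ is a finite sum $P=\sum_a t^af_a(s)$ with polynomials $f_a$ in the operators $s_j=t_j\partial_j$, and its formal adjoint is $P^*=\sum_a f_a(-s)t^a$. Then $$D(\omega(S))=D(S)^*:=\{P^*: P\in D(S)\},$$ and $P\mapsto P^*$ is an anti-isomorphism of $K$-algebras from $D(S)$ onto $D(\omega(S))$. -/

import Mathlib

/-! ### Differential operators -/

section DiffOps

variable (K R : Type*) {M N L : Type*} [CommRing K] [CommRing R] [Algebra K R]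
  [AddCommGroup M] [Module K M] [Module R M] [IsScalarTower K R M]
  [AddCommGroup N] [Module K N] [Module R N] [IsScalarTower K R N]
  [AddCommGroup L] [Module K L] [Module R L] [IsScalarTower K R L]

/-- The commutator `P r - r P` of a `K`-linear map `P : M → N` with an element `r` of `R`. -/
def opComm (P : M →ₗ[K] N) (r : R) : M →ₗ[K] N :=
  P ∘ₗ Algebra.lsmul K K M r - Algebra.lsmul K K N r ∘ₗ P

/-- `P : M → N` is a `K`-linear differential operator of order at most `k` between the
`R`-modules `M` and `N` (in the sense of Grothendieck); the operators of order at most `0` are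
the `R`-linear maps. -/
def IsDiffOpOfOrder : ℕ → (M →ₗ[K] N) → Prop
  | 0, P => ∀ r : R, opComm K R P r = 0
  | k + 1, P => ∀ r : R, IsDiffOpOfOrder k (opComm K R P r)

variable {K}

theorem opComm_add (P Q : M →ₗ[K] N) (r : R) :
    opComm K R (P + Q) r = opComm K R P r + opComm K R Q r := by
  ext x; simp [opComm]; abel

theorem opComm_comp (P : N →ₗ[K] L) (Q : M →ₗ[K] N) (r : R) :
    opComm K R (P ∘ₗ Q) r = P ∘ₗ opComm K R Q r + opComm K R P r ∘ₗ Q := by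
  ext x; simp [opComm]

theorem IsDiffOpOfOrder.zero (k : ℕ) : IsDiffOpOfOrder K R k (0 : M →ₗ[K] N) := by
  induction k with
  | zero => intro r; ext x; simp [opComm]
  | succ k ih =>
    intro r
    have : opComm K R (0 : M →ₗ[K] N) r = 0 := by ext x; simp [opComm]
    rw [this]; exact ih

theorem IsDiffOpOfOrder.add {k : ℕ} {P Q : M →ₗ[K] N}
    (hP : IsDiffOpOfOrder K R k P) (hQ : IsDiffOpOfOrder K R k Q) :
    IsDiffOpOfOrder K R k (P + Q) := by
  induction k generalizing P Q with
  | zero => intro r; rw [opComm_add, hP r, hQ r, add_zero]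
  | succ k ih => intro r; rw [opComm_add]; exact ih (hP r) (hQ r)

theorem IsDiffOpOfOrder.succ {k : ℕ} {P : M →ₗ[K] N}
    (hP : IsDiffOpOfOrder K R k P) : IsDiffOpOfOrder K R (k + 1) P := by
  induction k generalizing P with
  | zero => intro r; rw [hP r]; exact IsDiffOpOfOrder.zero R 0
  | succ k ih => intro r; exact ih (hP r)

theorem IsDiffOpOfOrder.mono {k l : ℕ} (h : k ≤ l) {P : M →ₗ[K] N}
    (hP : IsDiffOpOfOrder K R k P) : IsDiffOpOfOrder K R l P := by
  induction h with
  | refl => exact hP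
  | step _ ih => exact ih.succ

theorem IsDiffOpOfOrder.comp (n : ℕ) : ∀ {k l : ℕ} {P : N →ₗ[K] L} {Q : M →ₗ[K] N},
    k + l = n → IsDiffOpOfOrder K R k P → IsDiffOpOfOrder K R l Q →
    IsDiffOpOfOrder K R n (P ∘ₗ Q) := by
  induction n with
  | zero =>
    intro k l P Q h hP hQ r
    obtain ⟨rfl, rfl⟩ : k = 0 ∧ l = 0 := by omega
    rw [opComm_comp, hP r, hQ r]; simp
  | succ n ih =>
    intro k l P Q h hP hQ r
    rw [opComm_comp]
    refine IsDiffOpOfOrder.add R ?_ ?_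
    · cases l with
      | zero => rw [hQ r, LinearMap.comp_zero]; exact IsDiffOpOfOrder.zero R n
      | succ l => exact ih (by omega) hP (hQ r)
    · cases k with
      | zero => rw [hP r, LinearMap.zero_comp]; exact IsDiffOpOfOrder.zero R n
      | succ k => exact ih (by omega) (hP r) hQ

variable (K M)

/-- The ring `D(M)` of `K`-linear differential operators of an `R`-module `M`. -/
def diffOps : Subalgebra K (Module.End K M) where
  carrier := {P | ∃ k : ℕ, IsDiffOpOfOrder K R k P}
  mul_mem' := by
    rintro P Q ⟨k, hP⟩ ⟨l, hQ⟩
    exact ⟨k + l, IsDiffOpOfOrder.comp R (k + l) rfl hP hQ⟩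
  add_mem' := by
    rintro P Q ⟨k, hP⟩ ⟨l, hQ⟩
    exact ⟨max k l, (hP.mono R (le_max_left k l)).add R (hQ.mono R (le_max_right k l))⟩
  algebraMap_mem' := by
    intro c
    refine ⟨0, fun r => ?_⟩
    ext x
    simp [opComm, Module.algebraMap_end_apply, smul_comm c r x]

end DiffOps

/-! ### Operators on the Laurent polynomial ring -/

section Laurent

/-- The Laurent polynomial ring `K[ℤ^d] = K[t₁^{±1}, …, t_d^{±1}]`;
the monomial `t^a` is `AddMonoidAlgebra.single a 1`. -/
abbrev Laurent (K : Type*) [Field K] (d : ℕ) : Type _ := AddMonoidAlgebra K (Fin d → ℤ)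

variable {K : Type*} [Field K] {d : ℕ}

/-- The operator of multiplication by the monomial `t^a`. -/
noncomputable def monOp (K : Type*) [Field K] {d : ℕ} (a : Fin d → ℤ) :
    Module.End K (Laurent K d) :=
  LinearMap.mulLeft K (AddMonoidAlgebra.single a 1)

/-- The operator `f(s)`, for a polynomial `f` in the commuting Euler operators `s_j = t_j ∂_j`.
Since `s_j t^b = b_j t^b`, it is given by `f(s) t^b = f(b) t^b`. -/
noncomputable def polyOp (f : MvPolynomial (Fin d) K) : Module.End K (Laurent K d) :=
  (AddMonoidAlgebra.basis (Fin d → ℤ) K).constr K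
    (fun b => AddMonoidAlgebra.single b (MvPolynomial.eval (fun j => (b j : K)) f))

/-- The polynomial `f(-s)`. -/
noncomputable def negVars (f : MvPolynomial (Fin d) K) : MvPolynomial (Fin d) K :=
  MvPolynomial.aeval (fun j => -(MvPolynomial.X j : MvPolynomial (Fin d) K)) f

/-- `Q` is the formal adjoint operator `P^*` of `P`: for some finite family of polynomials `f_a`,
`P = ∑ t^a f_a(s)` and `Q = ∑ f_a(-s) t^a`. -/
def IsFormalAdjoint (P Q : Module.End K (Laurent K d)) : Prop :=
  ∃ f : (Fin d → ℤ) →₀ MvPolynomial (Fin d) K,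
    P = ∑ a ∈ f.support, monOp K a * polyOp (f a) ∧
    Q = ∑ a ∈ f.support, polyOp (negVars (f a)) * monOp K a

/-- The set `X^* = {P^* : P ∈ X}` of formal adjoints. -/
def formalAdjoints (X : Set (Module.End K (Laurent K d))) : Set (Module.End K (Laurent K d)) :=
  {Q | ∃ P ∈ X, IsFormalAdjoint P Q}

/-- The ring `D(S) = {P ∈ D(ℤ^d) : P(K[S]) ⊆ K[S]}`, for a subset `S` of `ℤ^d`, where
`D(ℤ^d)` is the ring of differential operators of the Laurent polynomial ring. -/
noncomputable def ringD (K : Type*) [Field K] {d : ℕ} (S : Set (Fin d → ℤ)) :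
    Subalgebra K (Module.End K (Laurent K d)) where
  carrier := {P | P ∈ diffOps K (Laurent K d) (Laurent K d) ∧
    ∀ g ∈ AddMonoidAlgebra.supported K K S, P g ∈ AddMonoidAlgebra.supported K K S}
  mul_mem' := by
    rintro P Q ⟨hP, hP'⟩ ⟨hQ, hQ'⟩
    exact ⟨mul_mem hP hQ, fun g hg => hP' _ (hQ' g hg)⟩
  add_mem' := by
    rintro P Q ⟨hP, hP'⟩ ⟨hQ, hQ'⟩
    exact ⟨add_mem hP hQ, fun g hg => add_mem (hP' g hg) (hQ' g hg)⟩
  algebraMap_mem' := by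
    intro c
    refine ⟨Subalgebra.algebraMap_mem _ c, fun g hg => ?_⟩
    rw [Module.algebraMap_end_apply]
    exact Submodule.smul_mem _ c hg

end Laurent

/-! ### The cone of `A`, its faces, and the sets attached to a standard expression -/

section Cone

open scoped Pointwise

variable {d : ℕ}

/-- An integer vector, viewed in `ℝ^d`. -/
def toReal (a : Fin d → ℤ) : Fin d → ℝ := fun j => (a j : ℝ)

/-- The cone `ℝ_{≥ 0} A`. -/
def coneOf (A : Finset (Fin d → ℤ)) : Set (Fin d → ℝ) :=
  (Submodule.span NNReal (toReal '' (A : Set (Fin d → ℤ))) : Set (Fin d → ℝ))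

/-- `τ` is a (nonempty) face of the cone `ℝ_{≥ 0} A`. -/
def IsConeFace (A : Finset (Fin d → ℤ)) (τ : Set (Fin d → ℝ)) : Prop :=
  ∃ l : (Fin d → ℝ) →ₗ[ℝ] ℝ, (∀ x ∈ coneOf A, 0 ≤ l x) ∧ τ = {x ∈ coneOf A | l x = 0}

/-- `σ` is a facet: a face of codimension one in `ℝ^d` (the cone has dimension `d` as soon as `A`
generates `ℤ^d`). -/
def IsConeFacet (A : Finset (Fin d → ℤ)) (σ : Set (Fin d → ℝ)) : Prop :=
  IsConeFace A σ ∧ Module.finrank ℝ (Submodule.span ℝ σ) + 1 = d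

/-- `F` is the primitive integral support function `F_σ` of the facet `σ`. -/
def IsPrimitiveSupport (A : Finset (Fin d → ℤ)) (σ : Set (Fin d → ℝ))
    (F : (Fin d → ℝ) →ₗ[ℝ] ℝ) : Prop :=
  (∀ x ∈ coneOf A, 0 ≤ F x) ∧ (∀ x ∈ σ, F x = 0) ∧
    (Set.range fun a : Fin d → ℤ => F (toReal a)) = Set.range ((↑) : ℤ → ℝ)

/-- The set `F(S)` of values of the linear form `F` on a set `S` of integer vectors. -/
def valueSet (F : (Fin d → ℝ) →ₗ[ℝ] ℝ) (S : Set (Fin d → ℤ)) : Set ℝ :=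
  (fun a => F (toReal a)) '' S

/-- `S` is an `ℕA`-set: `S + ℕA ⊆ S`. -/
def IsNASet (A : Finset (Fin d → ℤ)) (S : Set (Fin d → ℤ)) : Prop :=
  S + (AddSubmonoid.closure (A : Set (Fin d → ℤ)) : Set (Fin d → ℤ)) ⊆ S

/-- `S` is finitely generated as an `ℕA`-set. -/
def IsFGNASet (A : Finset (Fin d → ℤ)) (S : Set (Fin d → ℤ)) : Prop :=
  ∃ G : Finset (Fin d → ℤ), S = (G : Set (Fin d → ℤ)) +
    (AddSubmonoid.closure (A : Set (Fin d → ℤ)) : Set (Fin d → ℤ))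

/-- `S` is scored: it is the intersection, over the facets `σ`, of the sets
`{a ∈ ℤ^d : F_σ(a) ∈ F_σ(S)}`. -/
def IsScored (A : Finset (Fin d → ℤ)) (S : Set (Fin d → ℤ)) : Prop :=
  S = {a | ∀ σ F, IsConeFacet A σ → IsPrimitiveSupport A σ F → F (toReal a) ∈ valueSet F S}

/-- The group `ℤ(A ∩ τ)`. -/
def latticeOf (A : Finset (Fin d → ℤ)) (τ : Set (Fin d → ℝ)) : AddSubgroup (Fin d → ℤ) :=
  AddSubgroup.closure {a | a ∈ A ∧ toReal a ∈ τ}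

/-- The coset `b + ℤ(A ∩ τ)`. -/
def latticeCoset (A : Finset (Fin d → ℤ)) (b : Fin d → ℤ) (τ : Set (Fin d → ℝ)) :
    Set (Fin d → ℤ) :=
  {a | a - b ∈ latticeOf A τ}

/-- `S` is a set with scored closure `Sc` and standard expression
`S = Sc \ ⋃ i, (b i + ℤ(A ∩ τ i))`. -/
structure IsStandardExpression (A : Finset (Fin d → ℤ)) (Sc S : Set (Fin d → ℤ)) {m : ℕ}
    (b : Fin m → Fin d → ℤ) (τ : Fin m → Set (Fin d → ℝ)) : Prop where
  isNASet : IsNASet A Sc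
  fg : IsFGNASet A Sc
  scored : IsScored A Sc
  mem : ∀ i, b i ∈ Sc
  face : ∀ i, IsConeFace A (τ i)
  eq : S = Sc \ ⋃ i, latticeCoset A (b i) (τ i)
  irredundant : ∀ k, S ≠ Sc \ ⋃ i ∈ {i : Fin m | i ≠ k}, latticeCoset A (b i) (τ i)
  valueSet_eq : ∀ σ F, IsConeFacet A σ → IsPrimitiveSupport A σ F → valueSet F S = valueSet F Sc

/-- The set `F̃` of faces: all the facets together with the faces `τ i`. -/
def tildeF (A : Finset (Fin d → ℤ)) {m : ℕ} (τ : Fin m → Set (Fin d → ℝ)) :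
    Set (Set (Fin d → ℝ)) :=
  {ρ | IsConeFacet A ρ} ∪ Set.range τ

/-- The integer vectors in the `K`-span `Kτ` of a face `τ`. -/
def latticePointsOfSpan (K : Type*) [Field K] (A : Finset (Fin d → ℤ)) (τ : Set (Fin d → ℝ)) :
    Set (Fin d → ℤ) :=
  {v | (fun j => (v j : K)) ∈ Submodule.span K
    ((fun (a : Fin d → ℤ) (j : Fin d) => (a j : K)) '' {a | a ∈ A ∧ toReal a ∈ τ})}

/-- The set `𝓑`. An element is a family `(β_ρ)` of classes in `(Kρ ∩ ℤ^d) / ℤ(A ∩ ρ)`, for `ρ` in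
`F̃`; it is given here by representatives in `ℤ^d`, and only the values at `ρ` in `F̃` matter. -/
def setB (K : Type*) [Field K] (A : Finset (Fin d → ℤ)) {m : ℕ}
    (b : Fin m → Fin d → ℤ) (τ : Fin m → Set (Fin d → ℝ)) :
    Set (Set (Fin d → ℝ) → Fin d → ℤ) :=
  {β | (∀ ρ ∈ tildeF A τ, β ρ ∈ latticePointsOfSpan K A ρ) ∧
    ∀ i, ∀ ρ ∈ tildeF A τ, τ i ⊆ ρ →
      ∃ j, τ j = ρ ∧ (b i + β (τ i)) - (b j + β (τ j)) ∈ latticeOf A ρ}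

/-- The set `ω(S) = {a ∈ ℤ^d : -a - β_ρ ∉ S + ℤ(A ∩ ρ) for each ρ ∈ F̃}` attached to `β ∈ 𝓑`. -/
def omegaSet (A : Finset (Fin d → ℤ)) (S : Set (Fin d → ℤ)) {m : ℕ}
    (τ : Fin m → Set (Fin d → ℝ)) (β : Set (Fin d → ℝ) → Fin d → ℤ) : Set (Fin d → ℤ) :=
  {a | ∀ ρ ∈ tildeF A τ, -a - β ρ ∉ S + (latticeOf A ρ : Set (Fin d → ℤ))}

end Cone

/-!
Every differential operator of the Laurent polynomial ring is a finite sum `P = ∑ t^a f_a(s)`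
(`exists_symbolOp_of_mem_diffOps`): commutators with the variables lower the order, and a function
on `ℤ^d` with polynomial differences is polynomial in characteristic zero. Since
`P t^b = ∑ f_a(b) t^(a+b)`, the operator `P` lies in `D(S)` if and only if each `f_a` vanishes on the
exit set `{x ∈ S | x + a ∉ S}` (`symbolOp_mem_ringD_iff`). So `D(S)` depends only on the Zariski
closures of the exit sets of `S`.

The formal adjoint is the adjoint for the perfect pairing `⟨u, v⟩ = coeff₀ (u v)`
(`isFormalAdjoint_iff`, `IsFormalAdjoint.pairing_eq`). Hence it is unique, involutive and
anti-multiplicative, and `P^*` lies in `D(ω)` if and only if `P` lies in the ring `D` of the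
complement of `-ω` (`IsFormalAdjoint.mem_ringD_iff`). For `ω = ω(S)` this complement is the dual set
`S' = ⋃ (β_ρ + S + ℤ(A ∩ ρ))`, the union over `ρ ∈ F̃`, and everything reduces to `D(S') = D(S)`
(`ringD_dualSet`), that is, to the equality of the Zariski closures of the exit sets of `S` and `S'`.

* Let `x` be an exit point of `β_ρ + S + ℤ(A ∩ ρ)` for the shift `a`. All sufficiently deep
  translates of `x - β_ρ` by `ℕ(A ∩ ρ)` are exit points of `S`, and their Zariski closure contains
  `x - β_ρ + Kρ`, hence `x` (`eval_eq_zero_of_mem_exitSet_dualSet`).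
* Let `x` be an exit point of `S`. If `x + a` is in `Sc`, it lies in a removed coset of some
  `ρ₀ = τ i`; otherwise some facet form `F_σ` takes a value on `x + a` which it does not take on `S`,
  and `ρ₀ = σ`. The points of `x + β_ρ₀ + ℤ(A ∩ ρ₀)` far enough in the direction opposite to `ρ₀` are
  exit points of `S'`: for faces `ρ` not containing `ρ₀` because the form defining `ρ` is bounded
  below on `S`, and for `ρ ⊇ ρ₀` by the compatibility of `β`, respectively by the maximality of facets.
  Their Zariski closure contains `x` (`eval_eq_zero_of_forall_superface`,
  `eval_eq_zero_of_mem_exitSet`).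
-/

/-! ### Polynomial functions on the lattice -/

section PolynomialFunctions

variable {K : Type*} [Field K] {d : ℕ}

/-- An integer vector, viewed in `K^d`. -/
def toField (K : Type*) [Field K] {d : ℕ} (b : Fin d → ℤ) : Fin d → K := fun j => (b j : K)

theorem toField_add (a b : Fin d → ℤ) : toField K (a + b) = toField K a + toField K b := by
  ext j; simp [toField]

theorem toField_neg (b : Fin d → ℤ) : toField K (-b) = -toField K b := by
  ext j; simp [toField]

theorem toField_single (j : Fin d) : toField K (Pi.single j 1) = Pi.single j 1 := by
  ext i; by_cases h : i = j
  · subst h; simp [toField]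
  · simp [toField, h]

/-- Polynomials have polynomial antidifferences in each variable: for the powers of a variable
these are scaled Bernoulli polynomials. -/
theorem MvPolynomial.exists_antidifference [CharZero K] (p : MvPolynomial (Fin d) K) (j : Fin d) :
    ∃ q : MvPolynomial (Fin d) K, ∀ x : Fin d → K,
      eval (x + Pi.single j 1) q - eval x q = eval x p := by
  induction p using MvPolynomial.induction_on' with
  | monomial s c =>
    have hB (t : K) :
        Polynomial.aeval (t + 1) (Polynomial.bernoulli (s j + 1)) =
          Polynomial.aeval t (Polynomial.bernoulli (s j + 1)) + (s j + 1) * t ^ s j := by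
      have := congr(Polynomial.aeval t $(Polynomial.bernoulli_comp_one_add_X (s j + 1)))
      simpa [Polynomial.aeval_comp, add_comm] using this
    refine ⟨C (c / (s j + 1)) * (∏ i ∈ Finset.univ.erase j, X i ^ s i) *
      Polynomial.aeval (X j) (Polynomial.bernoulli (s j + 1)), fun x => ?_⟩
    have he (y : Fin d → K) :
        eval y (Polynomial.aeval (X j) (Polynomial.bernoulli (s j + 1))) =
          Polynomial.aeval (y j) (Polynomial.bernoulli (s j + 1)) := by
      have h := Polynomial.aeval_algHom_apply ((aeval (R := K) y).restrictScalars ℚ) (X j)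
        (Polynomial.bernoulli (s j + 1))
      simpa [coe_aeval_eq_eval] using h.symm
    have hp : ∏ i ∈ Finset.univ.erase j, (x i + Pi.single (M := fun _ => K) j 1 i) ^ s i =
        ∏ i ∈ Finset.univ.erase j, x i ^ s i := by
      refine Finset.prod_congr rfl fun i hi => ?_
      simp [Finset.ne_of_mem_erase hi]
    have h0 : (s j + 1 : K) ≠ 0 := by exact_mod_cast Nat.succ_ne_zero (s j)
    rw [eval_monomial, Finsupp.prod_fintype _ _ (by simp),
      ← Finset.mul_prod_erase _ _ (Finset.mem_univ j)]
    simp only [map_mul, map_prod, map_pow, eval_C, eval_X, he, Pi.add_apply, Pi.single_eq_same,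
      hB, hp]
    field_simp
    ring
  | add p q hp hq =>
    obtain ⟨u, hu⟩ := hp
    obtain ⟨v, hv⟩ := hq
    refine ⟨u + v, fun x => ?_⟩
    rw [map_add, map_add, map_add, ← hu, ← hv]
    ring

theorem apply_add_zsmul_single_of_periodic {X : Type*} {g : (Fin d → ℤ) → X} {j : Fin d}
    (h : ∀ b, g (b + Pi.single j 1) = g b) (b : Fin d → ℤ) (n : ℤ) :
    g (b + n • Pi.single j 1) = g b := by
  induction n using Int.induction_on with
  | zero => simp
  | succ n ih => rw [add_zsmul, one_zsmul, ← add_assoc, h, ih]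
  | pred n ih =>
    rw [← ih, ← h (b + (-(n : ℤ) - 1) • Pi.single j 1), add_assoc, ← add_one_zsmul, sub_add_cancel]

/-- The vector with the coordinates of `b` in `s` and zeros elsewhere. -/
def restrictTo (s : Finset (Fin d)) (b : Fin d → ℤ) : Fin d → ℤ := fun i => if i ∈ s then b i else 0

theorem restrictTo_empty (b : Fin d → ℤ) : restrictTo ∅ b = 0 := by
  ext i; simp [restrictTo]

theorem restrictTo_univ (b : Fin d → ℤ) : restrictTo Finset.univ b = b := by
  ext i; simp [restrictTo]

theorem restrictTo_insert {s : Finset (Fin d)} {j : Fin d} (hj : j ∉ s) (b : Fin d → ℤ) :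
    restrictTo (insert j s) b = restrictTo s b + b j • Pi.single j 1 := by
  ext i
  by_cases h : i = j
  · subst h; simp [restrictTo, hj]
  · simp [restrictTo, h]

theorem apply_eq_of_periodic {X : Type*} {g : (Fin d → ℤ) → X}
    (h : ∀ j b, g (b + Pi.single j 1) = g b) (b : Fin d → ℤ) : g b = g 0 := by
  have key (s : Finset (Fin d)) : g (restrictTo s b) = g 0 := by
    induction s using Finset.induction_on with
    | empty => rw [restrictTo_empty]
    | insert j s hj ih => rw [restrictTo_insert hj, apply_add_zsmul_single_of_periodic (h j), ih]
  rw [← key Finset.univ, restrictTo_univ]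

/-- A function on `ℤ^d` whose partial differences are polynomial functions is a polynomial
function. -/
theorem exists_eval_eq_of_differences [CharZero K] {g : (Fin d → ℤ) → K}
    {p : Fin d → MvPolynomial (Fin d) K}
    (h : ∀ j b, g (b + Pi.single j 1) - g b = MvPolynomial.eval (toField K b) (p j)) :
    ∃ q : MvPolynomial (Fin d) K, ∀ b, g b = MvPolynomial.eval (toField K b) q := by
  have hr (q : MvPolynomial (Fin d) K) (s : Finset (Fin d)) : ∃ q' : MvPolynomial (Fin d) K,
      ∀ b, MvPolynomial.eval (toField K (restrictTo s b)) q =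
        MvPolynomial.eval (toField K b) q' := by
    refine ⟨MvPolynomial.aeval (fun i => if i ∈ s then MvPolynomial.X i else 0) q, fun b => ?_⟩
    induction q using MvPolynomial.induction_on with
    | C a => simp
    | add p q hp hq => simp [hp, hq]
    | mul_X p i hp =>
      rw [map_mul, map_mul, map_mul, hp, MvPolynomial.eval_X, MvPolynomial.aeval_X]
      by_cases hi : i ∈ s <;> simp [hi, toField, restrictTo]
  have key (s : Finset (Fin d)) : ∃ q : MvPolynomial (Fin d) K,
      ∀ b, g (restrictTo s b) = MvPolynomial.eval (toField K b) q := by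
    induction s using Finset.induction_on with
    | empty =>
      refine ⟨MvPolynomial.C (g 0), fun b => ?_⟩
      rw [MvPolynomial.eval_C, restrictTo_empty]
    | insert j s hj ih =>
      obtain ⟨q, hq⟩ := ih
      obtain ⟨u, hu⟩ := (p j).exists_antidifference j
      obtain ⟨u₁, hu₁⟩ := hr u (insert j s)
      obtain ⟨u₂, hu₂⟩ := hr u s
      -- `g - u` does not depend on the `j`-th coordinate.
      have hper (b : Fin d → ℤ) :
          (fun b => g b - MvPolynomial.eval (toField K b) u) (b + Pi.single j 1) =
            (fun b => g b - MvPolynomial.eval (toField K b) u) b := by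
        have h1 := h j b
        have h2 := hu (toField K b)
        simp only [toField_add, toField_single]
        linear_combination h1 - h2
      refine ⟨q + u₁ - u₂, fun b => ?_⟩
      have h3 := apply_add_zsmul_single_of_periodic
        (g := fun b => g b - MvPolynomial.eval (toField K b) u) hper (restrictTo s b) (b j)
      simp only [← restrictTo_insert hj, hu₁, hu₂, hq] at h3
      simp only [map_add, map_sub]
      linear_combination h3
  obtain ⟨q, hq⟩ := key Finset.univ
  refine ⟨q, fun b => ?_⟩
  rw [← hq, restrictTo_univ]

end PolynomialFunctions

/-! ### Differential operators of the Laurent polynomial ring and their adjoints -/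

section LaurentOperators

open AddMonoidAlgebra

variable {K : Type*} [Field K] {d : ℕ}

theorem Laurent.end_ext {P Q : Module.End K (Laurent K d)}
    (h : ∀ b c, (P (single b 1)).coeff c = (Q (single b 1)).coeff c) : P = Q := by
  refine (AddMonoidAlgebra.basis (Fin d → ℤ) K).ext fun b => ?_
  rw [AddMonoidAlgebra.basis_apply]
  exact AddMonoidAlgebra.ext (Finsupp.ext (h b))

theorem Laurent.coeff_single_mul (b c : Fin d → ℤ) (u : Laurent K d) :
    (single b 1 * u).coeff c = u.coeff (c - b) := by
  rw [coeff_single_mul_eq_mul_coeff (c - b) fun x _ => eq_sub_iff_add_eq'.symm, one_mul]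

theorem monOp_single (a b : Fin d → ℤ) (r : K) : monOp K a (single b r) = single (a + b) r := by
  simp [monOp, AddMonoidAlgebra.single_mul_single]

theorem polyOp_single (f : MvPolynomial (Fin d) K) (b : Fin d → ℤ) (r : K) :
    polyOp f (single b r) = single b (r * MvPolynomial.eval (toField K b) f) := by
  have h : (single b r : Laurent K d) = r • AddMonoidAlgebra.basis (Fin d → ℤ) K b := by
    simp [AddMonoidAlgebra.basis_apply]
  rw [h, map_smul, polyOp, Module.Basis.constr_basis, AddMonoidAlgebra.smul_single, smul_eq_mul]
  rfl

theorem eval_negVars (f : MvPolynomial (Fin d) K) (x : Fin d → K) :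
    MvPolynomial.eval x (negVars f) = MvPolynomial.eval (-x) f := by
  unfold negVars
  induction f using MvPolynomial.induction_on with
  | C a => simp
  | add p q hp hq => rw [map_add, map_add, map_add, hp, hq]
  | mul_X p i hp => rw [map_mul, map_mul, map_mul, hp]; simp

/-- The operator `∑ t^a f_a(s)`. -/
noncomputable def symbolOp (f : (Fin d → ℤ) →₀ MvPolynomial (Fin d) K) :
    Module.End K (Laurent K d) :=
  ∑ a ∈ f.support, monOp K a * polyOp (f a)

/-- The operator `∑ f_a(-s) t^a`. -/
noncomputable def adjointSymbolOp (f : (Fin d → ℤ) →₀ MvPolynomial (Fin d) K) :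
    Module.End K (Laurent K d) :=
  ∑ a ∈ f.support, polyOp (negVars (f a)) * monOp K a

theorem coeff_sum_single_add (f : (Fin d → ℤ) →₀ MvPolynomial (Fin d) K)
    (g : (Fin d → ℤ) → K) (b c : Fin d → ℤ) (hg : c - b ∉ f.support → g (c - b) = 0) :
    (∑ a ∈ f.support, (single (a + b) (g a) : Laurent K d)).coeff c = g (c - b) := by
  rw [AddMonoidAlgebra.coeff_sum, Finsupp.finsetSum_apply, Finset.sum_eq_single (c - b)]
  · simp
  · intro a _ ha
    rw [AddMonoidAlgebra.coeff_single, Finsupp.single_eq_of_ne]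
    rintro rfl; simp at ha
  · intro h; simp [hg h]

theorem coeff_symbolOp (f : (Fin d → ℤ) →₀ MvPolynomial (Fin d) K) (b c : Fin d → ℤ) :
    (symbolOp f (single b 1)).coeff c = MvPolynomial.eval (toField K b) (f (c - b)) := by
  rw [← coeff_sum_single_add f (fun a => MvPolynomial.eval (toField K b) (f a)) b c
    (fun h => by simp [Finsupp.notMem_support_iff.1 h])]
  simp [symbolOp, LinearMap.sum_apply, polyOp_single, monOp_single]

theorem coeff_adjointSymbolOp (f : (Fin d → ℤ) →₀ MvPolynomial (Fin d) K) (b c : Fin d → ℤ) :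
    (adjointSymbolOp f (single b 1)).coeff c = MvPolynomial.eval (toField K (-c)) (f (c - b)) := by
  have h := coeff_sum_single_add f
    (fun a => MvPolynomial.eval (toField K (-(a + b))) (f a)) b c
    (fun h => by simp [Finsupp.notMem_support_iff.1 h])
  rw [sub_add_cancel] at h
  rw [← h]
  simp [adjointSymbolOp, LinearMap.sum_apply, polyOp_single, monOp_single, eval_negVars,
    ← toField_neg, add_comm]

theorem isDiffOpOfOrder_zero_mulLeft (u : Laurent K d) :
    IsDiffOpOfOrder K (Laurent K d) 0 (LinearMap.mulLeft K u) := by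
  intro r
  refine LinearMap.ext fun x => ?_
  simp [opComm, mul_left_comm]

theorem opComm_polyOp_X (j : Fin d) (r : Laurent K d) :
    opComm K (Laurent K d) (polyOp (MvPolynomial.X j)) r =
      LinearMap.mulLeft K (polyOp (MvPolynomial.X j) r) := by
  induction r using AddMonoidAlgebra.induction_linear with
  | zero => ext x; simp [opComm]
  | add r s hr hs =>
    refine LinearMap.ext fun x => ?_
    have h1 := LinearMap.congr_fun hr x
    have h2 := LinearMap.congr_fun hs x
    simp only [opComm, LinearMap.sub_apply, LinearMap.comp_apply, Algebra.lsmul_coe, smul_eq_mul,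
      LinearMap.mulLeft_apply] at h1 h2 ⊢
    rw [map_add, add_mul, add_mul, add_mul, map_add, ← h1, ← h2]
    abel
  | single c r =>
    refine (AddMonoidAlgebra.basis (Fin d → ℤ) K).ext fun b => ?_
    rw [AddMonoidAlgebra.basis_apply]
    simp only [opComm, LinearMap.sub_apply, LinearMap.comp_apply, Algebra.lsmul_coe, smul_eq_mul,
      single_mul_single, polyOp_single, LinearMap.mulLeft_apply, MvPolynomial.eval_X, toField,
      ← AddMonoidAlgebra.single_sub]
    congr 1
    simp; ring

theorem polyOp_mem_diffOps (f : MvPolynomial (Fin d) K) :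
    polyOp f ∈ diffOps K (Laurent K d) (Laurent K d) := by
  induction f using MvPolynomial.induction_on with
  | C a =>
    have : polyOp (MvPolynomial.C a) = algebraMap K (Module.End K (Laurent K d)) a := by
      refine Laurent.end_ext fun b c => ?_
      rw [polyOp_single, Module.algebraMap_end_apply, smul_single]; simp
    rw [this]; exact Subalgebra.algebraMap_mem _ a
  | add p q hp hq =>
    have : polyOp (p + q) = polyOp p + polyOp q := by
      refine Laurent.end_ext fun b c => ?_
      simp only [LinearMap.add_apply, polyOp_single, ← single_add, map_add, mul_add]
    rw [this]; exact add_mem hp hq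
  | mul_X p j hp =>
    have : polyOp (p * MvPolynomial.X j) = polyOp p * polyOp (MvPolynomial.X j) := by
      refine Laurent.end_ext fun b c => ?_
      simp only [Module.End.mul_apply, polyOp_single, map_mul, one_mul, mul_comm]
    rw [this]
    refine mul_mem hp ⟨1, fun r => ?_⟩
    rw [opComm_polyOp_X]
    exact isDiffOpOfOrder_zero_mulLeft _

theorem monOp_mem_diffOps (a : Fin d → ℤ) :
    monOp K a ∈ diffOps K (Laurent K d) (Laurent K d) := ⟨0, isDiffOpOfOrder_zero_mulLeft _⟩

theorem symbolOp_mem_diffOps (f : (Fin d → ℤ) →₀ MvPolynomial (Fin d) K) :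
    symbolOp f ∈ diffOps K (Laurent K d) (Laurent K d) :=
  sum_mem fun _ _ => mul_mem (monOp_mem_diffOps _) (polyOp_mem_diffOps _)

theorem adjointSymbolOp_mem_diffOps (f : (Fin d → ℤ) →₀ MvPolynomial (Fin d) K) :
    adjointSymbolOp f ∈ diffOps K (Laurent K d) (Laurent K d) :=
  sum_mem fun _ _ => mul_mem (polyOp_mem_diffOps _) (monOp_mem_diffOps _)

/-- An operator is of the form `∑ t^a f_a(s)` as soon as its commutators with the variables are:
the matrix coefficients of `P` along a fixed shift `a` then have polynomial differences. -/
theorem exists_symbolOp_of_opComm [CharZero K] {P : Module.End K (Laurent K d)}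
    (h : ∀ j : Fin d, ∃ f, opComm K (Laurent K d) P (single (Pi.single j 1) 1) = symbolOp f) :
    ∃ f, P = symbolOp f := by
  classical
  choose f hf using h
  have hdiff (a : Fin d → ℤ) (j : Fin d) (b : Fin d → ℤ) :
      (P (single (b + Pi.single j 1) 1)).coeff (a + (b + Pi.single j 1)) -
        (P (single b 1)).coeff (a + b) =
          MvPolynomial.eval (toField K b) (f j (a + Pi.single j 1)) := by
    have h1 := coeff_symbolOp (f j) b (a + (b + Pi.single j 1))
    rw [← hf j] at h1
    have h2 : a + (b + Pi.single j 1) - b = a + Pi.single j 1 := by abel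
    have h3 : a + (Pi.single j 1 + b) = Pi.single j 1 + (a + b) := by abel
    rw [h2] at h1
    rw [← h1]
    simp only [opComm, LinearMap.sub_apply, LinearMap.comp_apply, Algebra.lsmul_coe, smul_eq_mul,
      single_mul_single, mul_one, AddMonoidAlgebra.coeff_sub, Finsupp.sub_apply]
    rw [add_comm b (Pi.single j 1)]
    congr 1
    rw [h3, Laurent.coeff_single_mul, add_sub_cancel_left]
  choose q hq using fun a => exists_eval_eq_of_differences
    (g := fun b => (P (single b 1)).coeff (a + b)) (hdiff a)
  -- Outside this finite set of shifts the coefficients are constant and vanish at `t^0`.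
  let T : Finset (Fin d → ℤ) := (P (single 0 1)).coeff.support ∪
    Finset.univ.biUnion fun j => (f j).support.image fun c => c - Pi.single j 1
  have hT (a : Fin d → ℤ) (ha : a ∉ T) (b : Fin d → ℤ) : (P (single b 1)).coeff (a + b) = 0 := by
    simp only [T, Finset.mem_union, Finset.mem_biUnion, Finset.mem_univ, true_and, Finset.mem_image,
      not_or, not_exists, not_and, Finsupp.notMem_support_iff] at ha
    have hper := apply_eq_of_periodic (g := fun b => (P (single b 1)).coeff (a + b))
      (fun j b => by
        rw [← sub_eq_zero, hdiff a j b]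
        have h0 : f j (a + Pi.single j 1) = 0 := by
          by_contra h0
          exact ha.2 j _ (Finsupp.mem_support_iff.2 h0) (by simp)
        rw [h0, map_zero]) b
    simpa [ha.1] using hper
  refine ⟨Finsupp.onFinset T (fun a => if a ∈ T then q a else 0)
    (fun a ha => by by_contra h; simp [h] at ha), Laurent.end_ext fun b c => ?_⟩
  rw [coeff_symbolOp, Finsupp.onFinset_apply]
  split_ifs with hc
  · rw [← hq, sub_add_cancel]
  · have := hT _ hc b
    rwa [sub_add_cancel] at this

/-- In characteristic zero, every differential operator of the Laurent polynomial ring is a finite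
sum `∑ t^a f_a(s)`. -/
theorem exists_symbolOp_of_mem_diffOps [CharZero K] {P : Module.End K (Laurent K d)}
    (hP : P ∈ diffOps K (Laurent K d) (Laurent K d)) : ∃ f, P = symbolOp f := by
  obtain ⟨k, hk⟩ := hP
  induction k generalizing P with
  | zero => exact exists_symbolOp_of_opComm fun j => ⟨0, by rw [hk]; simp [symbolOp]⟩
  | succ k ih => exact exists_symbolOp_of_opComm fun j => ih (hk _)

/-- The matrix form of adjointness with respect to the pairing `⟨u, v⟩ = coeff₀ (u v)`, for which
`t^b` and `t^(-b)` are dual to each other. -/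
theorem isFormalAdjoint_iff [CharZero K] {P Q : Module.End K (Laurent K d)} :
    IsFormalAdjoint P Q ↔ P ∈ diffOps K (Laurent K d) (Laurent K d) ∧
      ∀ b c, (P (single b 1)).coeff c = (Q (single (-c) 1)).coeff (-b) := by
  have hadj (f : (Fin d → ℤ) →₀ MvPolynomial (Fin d) K) (b c : Fin d → ℤ) :
      (symbolOp f (single b 1)).coeff c = (adjointSymbolOp f (single (-c) 1)).coeff (-b) := by
    rw [coeff_symbolOp, coeff_adjointSymbolOp, neg_neg, neg_sub_neg]
  constructor
  · rintro ⟨f, rfl, rfl⟩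
    exact ⟨symbolOp_mem_diffOps f, hadj f⟩
  · rintro ⟨hP, h⟩
    obtain ⟨f, rfl⟩ := exists_symbolOp_of_mem_diffOps hP
    refine ⟨f, rfl, Laurent.end_ext fun b c => ?_⟩
    have h1 := h (-c) (-b)
    rw [neg_neg, neg_neg] at h1
    rw [← h1, hadj, neg_neg, neg_neg]
    rfl

theorem IsFormalAdjoint.mem_diffOps {P Q : Module.End K (Laurent K d)}
    (h : IsFormalAdjoint P Q) : Q ∈ diffOps K (Laurent K d) (Laurent K d) := by
  obtain ⟨f, -, rfl⟩ := h
  exact adjointSymbolOp_mem_diffOps f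

theorem IsFormalAdjoint.symm [CharZero K] {P Q : Module.End K (Laurent K d)}
    (h : IsFormalAdjoint P Q) : IsFormalAdjoint Q P :=
  isFormalAdjoint_iff.2 ⟨h.mem_diffOps, fun b c => by
    rw [(isFormalAdjoint_iff.1 h).2, neg_neg, neg_neg]⟩

theorem IsFormalAdjoint.unique [CharZero K] {P Q Q' : Module.End K (Laurent K d)}
    (h : IsFormalAdjoint P Q) (h' : IsFormalAdjoint P Q') : Q = Q' :=
  Laurent.end_ext fun b c => by
    rw [← neg_neg b, ← neg_neg c, ← (isFormalAdjoint_iff.1 h).2, ← (isFormalAdjoint_iff.1 h').2]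

theorem exists_isFormalAdjoint [CharZero K] {P : Module.End K (Laurent K d)}
    (hP : P ∈ diffOps K (Laurent K d) (Laurent K d)) : ∃ Q, IsFormalAdjoint P Q := by
  obtain ⟨f, rfl⟩ := exists_symbolOp_of_mem_diffOps hP
  exact ⟨adjointSymbolOp f, f, rfl, rfl⟩

theorem IsFormalAdjoint.add [CharZero K] {P P' Q Q' : Module.End K (Laurent K d)}
    (h : IsFormalAdjoint P Q) (h' : IsFormalAdjoint P' Q') :
    IsFormalAdjoint (P + P') (Q + Q') := by
  rw [isFormalAdjoint_iff] at *
  exact ⟨add_mem h.1 h'.1, fun b c => by simp [h.2, h'.2]⟩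

theorem IsFormalAdjoint.algebraMap [CharZero K] (r : K) :
    IsFormalAdjoint (algebraMap K (Module.End K (Laurent K d)) r)
      (algebraMap K (Module.End K (Laurent K d)) r) := by
  refine isFormalAdjoint_iff.2 ⟨Subalgebra.algebraMap_mem _ r, fun b c => ?_⟩
  have : b = c ↔ -c = -b := by rw [neg_inj, eq_comm]
  classical
  simp only [Module.algebraMap_end_apply, smul_single, coeff_single, Finsupp.single_apply, this]

theorem Laurent.coeff_apply (P : Module.End K (Laurent K d)) (u : Laurent K d) (c : Fin d → ℤ) :
    (P u).coeff c = u.coeff.sum fun b r => r * (P (single b 1)).coeff c := by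
  induction u using AddMonoidAlgebra.induction_linear with
  | zero => simp
  | add u v hu hv =>
    rw [map_add, AddMonoidAlgebra.coeff_add, Finsupp.add_apply, hu, hv, AddMonoidAlgebra.coeff_add,
      Finsupp.sum_add_index' (by simp) (by simp [add_mul])]
  | single b r =>
    have : (single b r : Laurent K d) = r • single b 1 := by simp
    rw [this, map_smul, ← this]
    simp

/-- The perfect pairing of the Laurent polynomial ring with itself for which `t^b` and `t^(-b)` are
dual to each other. -/
noncomputable def pairing (u v : Laurent K d) : K := (u * v).coeff 0

theorem pairing_single_left (b : Fin d → ℤ) (v : Laurent K d) :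
    pairing (single b 1) v = v.coeff (-b) := by
  rw [pairing, Laurent.coeff_single_mul, zero_sub]

theorem pairing_comm (u v : Laurent K d) : pairing u v = pairing v u := by
  rw [pairing, mul_comm, pairing]

theorem pairing_add_left (u u' v : Laurent K d) :
    pairing (u + u') v = pairing u v + pairing u' v := by
  simp [pairing, add_mul]

theorem pairing_add_right (u v v' : Laurent K d) :
    pairing u (v + v') = pairing u v + pairing u v' := by
  simp [pairing, mul_add]

theorem IsFormalAdjoint.pairing_eq [CharZero K] {P Q : Module.End K (Laurent K d)}
    (h : IsFormalAdjoint P Q) (u v : Laurent K d) : pairing (P u) v = pairing u (Q v) := by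
  induction u using AddMonoidAlgebra.induction_linear with
  | zero => simp [pairing]
  | add u u' hu hu' => rw [map_add, pairing_add_left, pairing_add_left, hu, hu']
  | single b r =>
    induction v using AddMonoidAlgebra.induction_linear with
    | zero => simp [pairing]
    | add v v' hv hv' => rw [map_add, pairing_add_right, pairing_add_right, hv, hv']
    | single c t =>
      have hb : (single b r : Laurent K d) = r • single b 1 := by simp
      have hc : (single c t : Laurent K d) = t • single c 1 := by simp
      have key : pairing (P (single b 1)) (single c 1) = pairing (single b 1) (Q (single c 1)) := by
        rw [pairing_comm, pairing_single_left, pairing_single_left, (isFormalAdjoint_iff.1 h).2,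
          neg_neg]
      rw [hb, hc, map_smul, map_smul]
      simp only [pairing, smul_mul_smul_comm, coeff_smul, Finsupp.smul_apply] at key ⊢
      rw [key]

theorem IsFormalAdjoint.mul [CharZero K] {P P' Q Q' : Module.End K (Laurent K d)}
    (h : IsFormalAdjoint P Q) (h' : IsFormalAdjoint P' Q') :
    IsFormalAdjoint (P * P') (Q' * Q) := by
  refine isFormalAdjoint_iff.2 ⟨mul_mem (isFormalAdjoint_iff.1 h).1 (isFormalAdjoint_iff.1 h').1,
    fun b c => ?_⟩
  rw [← pairing_single_left b, Module.End.mul_apply, Module.End.mul_apply, ← h'.pairing_eq,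
    ← h.pairing_eq, pairing_comm, pairing_single_left, neg_neg]

theorem map_supported_iff (P : Module.End K (Laurent K d)) (S : Set (Fin d → ℤ)) :
    (∀ g ∈ supported K K S, P g ∈ supported K K S) ↔
      ∀ b ∈ S, ∀ c ∉ S, (P (single b 1)).coeff c = 0 := by
  constructor
  · intro h b hb c hc
    refine mem_supported'.1 (h (single b 1) (mem_supported'.2 fun x hx => ?_)) c hc
    rw [coeff_single, Finsupp.single_eq_of_ne]
    rintro rfl; exact hx hb
  · intro h g hg
    refine mem_supported'.2 fun c hc => ?_
    rw [Laurent.coeff_apply]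
    refine Finset.sum_eq_zero fun b hb => ?_
    exact mul_eq_zero_of_right _ (h b (mem_supported.1 hg hb) c hc)

end LaurentOperators

/-! ### Zariski density of monoids of integer vectors -/

section ZariskiDensity

variable {K : Type*} [Field K] {d : ℕ}

/-- A translate of a monoid of integer vectors is Zariski dense in the corresponding translate of
the linear space it spans. -/
theorem MvPolynomial.eval_add_eq_zero_of_mem_span [CharZero K] (p : MvPolynomial (Fin d) K)
    (W : Set (Fin d → ℤ)) {w : Fin d → K} (hw : w ∈ Submodule.span K (toField K '' W))
    (y : Fin d → K) (h : ∀ e ∈ AddSubmonoid.closure W, eval (y + toField K e) p = 0) :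
    eval (y + w) p = 0 := by
  suffices H : ∀ y : Fin d → K, (∀ e ∈ AddSubmonoid.closure W, eval (y + toField K e) p = 0) →
      ∀ e ∈ AddSubmonoid.closure W, eval (y + w + toField K e) p = 0 by
    have := H y h 0 (zero_mem _)
    have h0 : toField K (0 : Fin d → ℤ) = 0 := by ext; simp [toField]
    rwa [h0, add_zero] at this
  clear h y
  induction hw using Submodule.closure_induction with
  | zero => simp
  | add u v _ _ hu hv =>
    intro y h
    rw [← add_assoc]
    exact hv _ (hu y h)
  | smul_mem r _ hx =>
    obtain ⟨a, ha, rfl⟩ := hx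
    intro y h e he
    -- Along the line in direction `a`, the polynomial has all natural numbers as roots.
    let g : Polynomial K := aeval
      (fun j => Polynomial.C (y j + (e j : K)) + Polynomial.X * Polynomial.C (a j : K)) p
    have hg (t : K) : g.eval t = eval (y + t • toField K a + toField K e) p := by
      have : g.eval t = (Polynomial.aeval t : Polynomial K →ₐ[K] K) g := by simp
      rw [this, ← AlgHom.comp_apply, comp_aeval, ← coe_aeval_eq_eval]
      refine congr_arg (fun z : Fin d → K => aeval z p) ?_
      ext j
      simp [toField]; ring
    have hz : g = 0 := by
      refine g.eq_zero_of_infinite_isRoot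
        ((Set.infinite_range_of_injective (Nat.cast_injective (R := K))).mono ?_)
      rintro _ ⟨n, rfl⟩
      have h1 := h (n • a + e) (add_mem (nsmul_mem (AddSubmonoid.subset_closure ha) n) he)
      rw [Set.mem_ofPred_eq, Polynomial.IsRoot, hg, ← h1]
      congr 2
      ext j; simp [toField]; ring
    rw [← hg, hz, Polynomial.eval_zero]

end ZariskiDensity

/-! ### Faces of the cone and forms on the lattice -/

section Faces

open scoped Pointwise

variable {d : ℕ}

/-- The restriction of a real linear form to the integer vectors. -/
def formOn (l : (Fin d → ℝ) →ₗ[ℝ] ℝ) : (Fin d → ℤ) →+ ℝ where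
  toFun a := l (toReal a)
  map_zero' := by rw [← map_zero l]; congr 1; ext; simp [toReal]
  map_add' a b := by rw [← map_add]; congr 1; ext; simp [toReal]

theorem toReal_mem_coneOf {A : Finset (Fin d → ℤ)} {a : Fin d → ℤ} (ha : a ∈ A) :
    toReal a ∈ coneOf A :=
  Submodule.subset_span ⟨a, ha, rfl⟩

/-- The elements of `A` in the face `τ`. -/
def generatorsIn (A : Finset (Fin d → ℤ)) (τ : Set (Fin d → ℝ)) : Set (Fin d → ℤ) :=
  {a | a ∈ A ∧ toReal a ∈ τ}

theorem IsConeFace.subset_iff {A : Finset (Fin d → ℤ)} {τ ρ : Set (Fin d → ℝ)}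
    (hτ : IsConeFace A τ) (hρ : IsConeFace A ρ) :
    τ ⊆ ρ ↔ generatorsIn A τ ⊆ generatorsIn A ρ := by
  refine ⟨fun h a ha => ⟨ha.1, h ha.2⟩, fun h => ?_⟩
  obtain ⟨k, hk, rfl⟩ := hτ
  obtain ⟨l, hl, rfl⟩ := hρ
  rintro x ⟨hx, hx0⟩
  refine ⟨hx, ?_⟩
  change x ∈ Submodule.span NNReal _ at hx
  induction hx using Submodule.span_induction with
  | mem x hx =>
    obtain ⟨a, ha, rfl⟩ := hx
    exact (h ⟨ha, toReal_mem_coneOf ha, hx0⟩).2.2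
  | zero => exact map_zero l
  | add x y hx hy ihx ihy =>
    have h1 := hk x hx
    have h2 := hk y hy
    rw [map_add] at hx0 ⊢
    rw [ihx (by linarith), ihy (by linarith), add_zero]
  | smul r x hx ih =>
    rw [NNReal.smul_def, map_smul, smul_eq_zero] at hx0 ⊢
    exact hx0.imp_right ih

theorem finite_setOf_isConeFace (A : Finset (Fin d → ℤ)) : {ρ | IsConeFace A ρ}.Finite := by
  refine Set.Finite.of_finite_image (f := generatorsIn A)
    (A.finite_toSet.finite_subsets.subset ?_) ?_
  · rintro _ ⟨ρ, -, rfl⟩ a ha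
    exact ha.1
  · intro ρ hρ τ hτ h
    exact ((hρ.subset_iff hτ).2 h.le).antisymm ((hτ.subset_iff hρ).2 h.ge)

theorem formOn_eq_zero_of_mem_latticeOf {A : Finset (Fin d → ℤ)} {ρ : Set (Fin d → ℝ)}
    {l : (Fin d → ℝ) →ₗ[ℝ] ℝ} (hl : ∀ x ∈ ρ, l x = 0) {z : Fin d → ℤ} (hz : z ∈ latticeOf A ρ) :
    formOn l z = 0 := by
  have : latticeOf A ρ ≤ (formOn l).ker := (AddSubgroup.closure_le _).2 fun a ha => hl _ ha.2
  exact this hz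

theorem formOn_nonneg_of_mem_closure {A : Finset (Fin d → ℤ)} {W : Set (Fin d → ℤ)}
    (hW : W ⊆ A) {l : (Fin d → ℝ) →ₗ[ℝ] ℝ} (hl : ∀ x ∈ coneOf A, 0 ≤ l x) {e : Fin d → ℤ}
    (he : e ∈ AddSubmonoid.closure W) : 0 ≤ formOn l e := by
  induction he using AddSubmonoid.closure_induction with
  | mem a ha => exact hl _ (toReal_mem_coneOf (hW ha))
  | zero => simp
  | add a b _ _ ha hb => rw [map_add]; exact add_nonneg ha hb

theorem IsFGNASet.exists_le_formOn {A : Finset (Fin d → ℤ)} {S : Set (Fin d → ℤ)}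
    (hS : IsFGNASet A S) {l : (Fin d → ℝ) →ₗ[ℝ] ℝ} (hl : ∀ x ∈ coneOf A, 0 ≤ l x) :
    ∃ C, ∀ s ∈ S, C ≤ formOn l s := by
  obtain ⟨G, rfl⟩ := hS
  obtain ⟨C, hC⟩ := (G.image (formOn l)).bddBelow
  refine ⟨C, ?_⟩
  rintro _ ⟨g, hg, e, he, rfl⟩
  have h1 := hC (Finset.mem_coe.2 (Finset.mem_image_of_mem _ hg))
  have h2 := formOn_nonneg_of_mem_closure subset_rfl hl he
  simp only [map_add]
  linarith

/-- Every element of the group generated by `W` is moved into the monoid generated by `W` by some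
element of that monoid. -/
theorem exists_add_mem_closure_of_mem_addSubgroupClosure {G : Type*} [AddCommGroup G] {W : Set G}
    {z : G} (hz : z ∈ AddSubgroup.closure W) :
    ∃ c ∈ AddSubmonoid.closure W, z + c ∈ AddSubmonoid.closure W := by
  induction hz using AddSubgroup.closure_induction with
  | mem x hx => exact ⟨0, zero_mem _, by simpa using AddSubmonoid.subset_closure hx⟩
  | zero => exact ⟨0, zero_mem _, by simp⟩
  | add x y _ _ hx hy =>
    obtain ⟨c, hc, hxc⟩ := hx
    obtain ⟨e, he, hye⟩ := hy
    exact ⟨c + e, add_mem hc he, by rw [add_add_add_comm]; exact add_mem hxc hye⟩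
  | neg x _ hx =>
    obtain ⟨c, hc, hxc⟩ := hx
    exact ⟨x + c, hxc, by simpa using hc⟩

theorem closure_generatorsIn_le_latticeOf (A : Finset (Fin d → ℤ)) (ρ : Set (Fin d → ℝ)) :
    AddSubmonoid.closure (generatorsIn A ρ) ≤ (latticeOf A ρ).toAddSubmonoid :=
  (AddSubmonoid.closure_le).2 AddSubgroup.subset_closure

theorem IsNASet.add_mem {A : Finset (Fin d → ℤ)} {S : Set (Fin d → ℤ)} (hS : IsNASet A S)
    {ρ : Set (Fin d → ℝ)} {s e : Fin d → ℤ} (hs : s ∈ S)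
    (he : e ∈ AddSubmonoid.closure (generatorsIn A ρ)) : s + e ∈ S :=
  hS ⟨s, hs, e, AddSubmonoid.closure_mono (fun _ ha => ha.1) he, rfl⟩

/-- Finitely many conditions, each of which holds far enough inside a commutative monoid, hold
simultaneously far enough inside it. -/
theorem AddSubmonoid.exists_forall_mem_of_finite {G ι : Type*} [AddCommMonoid G]
    (M : AddSubmonoid G) {T : Set ι} (hT : T.Finite) {Q : ι → G → Prop}
    (h : ∀ i ∈ T, ∃ c ∈ M, ∀ e ∈ M, Q i (c + e)) : ∃ c ∈ M, ∀ e ∈ M, ∀ i ∈ T, Q i (c + e) := by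
  induction T, hT using Set.Finite.induction_on with
  | empty => exact ⟨0, M.zero_mem, by simp⟩
  | @insert j T _ _ ih =>
    obtain ⟨c, hc, hQ⟩ := ih fun i hi => h i (Set.mem_insert_of_mem j hi)
    obtain ⟨c', hc', hQ'⟩ := h j (Set.mem_insert j T)
    refine ⟨c + c', add_mem hc hc', fun e he i hi => ?_⟩
    rcases hi with rfl | hi
    · rw [add_comm c, add_assoc]; exact hQ' _ (add_mem hc he)
    · rw [add_assoc]; exact hQ _ (add_mem hc' he) i hi

/-- Far enough in the direction opposite to a face `τ`, all points lie outside
`S + ℤ(A ∩ ρ)` if `ρ` does not contain `τ`: the form defining `ρ` is bounded below on `S`. -/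
theorem exists_sub_notMem_add_latticeOf {A : Finset (Fin d → ℤ)} {S Sc : Set (Fin d → ℤ)}
    (hSc : IsFGNASet A Sc) (hS : S ⊆ Sc) {τ ρ : Set (Fin d → ℝ)} (hτ : IsConeFace A τ)
    (hρ : IsConeFace A ρ) (h : ¬ τ ⊆ ρ) (u : Fin d → ℤ) :
    ∃ c ∈ AddSubmonoid.closure (generatorsIn A τ),
      ∀ e ∈ AddSubmonoid.closure (generatorsIn A τ),
        u - (c + e) ∉ S + (latticeOf A ρ : Set (Fin d → ℤ)) := by
  rw [hτ.subset_iff hρ, Set.not_subset] at h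
  obtain ⟨a, haτ, haρ⟩ := h
  obtain ⟨l, hl, rfl⟩ := hρ
  have hpos : 0 < formOn l a := by
    refine (hl _ (toReal_mem_coneOf haτ.1)).lt_of_ne fun h0 => ?_
    exact haρ ⟨haτ.1, toReal_mem_coneOf haτ.1, h0.symm⟩
  obtain ⟨C, hC⟩ := hSc.exists_le_formOn hl
  obtain ⟨n, hn⟩ := exists_nat_gt ((formOn l u - C) / formOn l a)
  rw [div_lt_iff₀ hpos] at hn
  refine ⟨n • a, nsmul_mem (AddSubmonoid.subset_closure haτ) n, fun e he => ?_⟩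
  rintro ⟨s, hs, z, hz, hsz⟩
  have h1 := congr_arg (formOn l) hsz
  have h2 := hC s (hS hs)
  have h3 := formOn_nonneg_of_mem_closure (fun _ ha => ha.1) hl he
  simp only [map_add, map_sub, map_nsmul,
    formOn_eq_zero_of_mem_latticeOf (fun x hx => hx.2) hz] at h1
  rw [nsmul_eq_mul] at h1
  linarith

/-- Facets are maximal among the proper faces. -/
theorem IsConeFacet.eq_of_subset {A : Finset (Fin d → ℤ)} {σ ρ : Set (Fin d → ℝ)}
    (hσ : IsConeFacet A σ) (hρ : IsConeFace A ρ) (hne : ρ ≠ coneOf A) (h : σ ⊆ ρ) : ρ = σ := by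
  obtain ⟨⟨k, hk, hσk⟩, hdim⟩ := hσ
  obtain ⟨l, hl, hρl⟩ := hρ
  refine Set.Subset.antisymm ?_ h
  have hle : Submodule.span ℝ σ ≤ Submodule.span ℝ ρ := Submodule.span_mono h
  have hkσ : Submodule.span ℝ σ ≤ LinearMap.ker k :=
    Submodule.span_le.2 fun x hx => by rw [hσk] at hx; exact hx.2
  rcases hle.eq_or_lt with heq | hlt
  · intro x hx
    have h1 : x ∈ Submodule.span ℝ σ := heq ▸ Submodule.subset_span hx
    rw [hρl] at hx
    rw [hσk]
    exact ⟨hx.1, hkσ h1⟩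
  · exfalso
    have h1 := Submodule.finrank_lt_finrank_of_lt hlt
    have h2 := Submodule.finrank_le (Submodule.span ℝ ρ)
    rw [Module.finrank_fin_fun] at h2
    have htop : Submodule.span ℝ ρ = ⊤ :=
      Submodule.eq_top_of_finrank_eq (by rw [Module.finrank_fin_fun]; omega)
    have hlρ : Submodule.span ℝ ρ ≤ LinearMap.ker l :=
      Submodule.span_le.2 fun x hx => by rw [hρl] at hx; exact hx.2
    refine hne ?_
    rw [hρl]
    ext x
    refine ⟨fun hx => hx.1, fun hx => ⟨hx, hlρ (htop ▸ Submodule.mem_top)⟩⟩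

theorem latticeOf_coneOf {A : Finset (Fin d → ℤ)}
    (hA : AddSubgroup.closure (A : Set (Fin d → ℤ)) = ⊤) : latticeOf A (coneOf A) = ⊤ := by
  rw [← hA, latticeOf]
  congr 1
  ext a
  exact ⟨fun h => h.1, fun h => ⟨h, toReal_mem_coneOf h⟩⟩

/-- A facet is a proper face. -/
theorem IsConeFacet.ne_coneOf {A : Finset (Fin d → ℤ)}
    (hA : AddSubgroup.closure (A : Set (Fin d → ℤ)) = ⊤) {σ : Set (Fin d → ℝ)}
    (hσ : IsConeFacet A σ) : σ ≠ coneOf A := by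
  rintro rfl
  obtain ⟨-, hdim⟩ := hσ
  have htop : Submodule.span ℝ (coneOf A) = ⊤ := by
    have hZ (a : Fin d → ℤ) : toReal a ∈ Submodule.span ℝ (coneOf A) := by
      have ha : a ∈ AddSubgroup.closure (A : Set (Fin d → ℤ)) := hA ▸ AddSubgroup.mem_top a
      induction ha using AddSubgroup.closure_induction with
      | mem a ha => exact Submodule.subset_span (toReal_mem_coneOf ha)
      | zero => convert Submodule.zero_mem (Submodule.span ℝ (coneOf A)); ext; simp [toReal]
      | add a b _ _ ha hb => convert add_mem ha hb; ext; simp [toReal]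
      | neg a _ ha => convert neg_mem ha; ext; simp [toReal]
    rw [eq_top_iff, ← (Pi.basisFun ℝ (Fin d)).span_eq, Submodule.span_le]
    rintro _ ⟨j, rfl⟩
    convert! hZ (Pi.single j 1) using 1
    ext i
    by_cases h : i = j
    · subst h; simp [toReal]
    · simp [toReal, h]
  rw [htop, finrank_top, Module.finrank_fin_fun] at hdim
  omega

end Faces

/-! ### Exit sets of the dual set -/

section DualSet

open scoped Pointwise

variable {K : Type*} [Field K] {d : ℕ}

/-- The complement of `-ω(S)`: the union over `ρ ∈ F̃` of the sets `β_ρ + S + ℤ(A ∩ ρ)`. -/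
def dualSet (A : Finset (Fin d → ℤ)) (S : Set (Fin d → ℤ)) {m : ℕ}
    (τ : Fin m → Set (Fin d → ℝ)) (β : Set (Fin d → ℝ) → Fin d → ℤ) : Set (Fin d → ℤ) :=
  {x | ∃ ρ ∈ tildeF A τ, x - β ρ ∈ S + (latticeOf A ρ : Set (Fin d → ℤ))}

/-- The points of `S` which the shift by `a` moves out of `S`. -/
def exitSet (S : Set (Fin d → ℤ)) (a : Fin d → ℤ) : Set (Fin d → ℤ) := {x ∈ S | x + a ∉ S}

theorem toField_mem_span {A : Finset (Fin d → ℤ)} {ρ : Set (Fin d → ℝ)} {c : Fin d → ℤ}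
    (hc : c ∈ AddSubmonoid.closure (generatorsIn A ρ)) :
    toField K c ∈ Submodule.span K (toField K '' generatorsIn A ρ) := by
  induction hc using AddSubmonoid.closure_induction with
  | mem c hc => exact Submodule.subset_span ⟨c, hc, rfl⟩
  | zero =>
    convert Submodule.zero_mem (Submodule.span K (toField K '' generatorsIn A ρ))
    ext; simp [toField]
  | add c c' _ _ h h' => rw [toField_add]; exact add_mem h h'

/-- A polynomial vanishing on `exitSet S a` vanishes on `exitSet (dualSet A S τ β) a`: an exit point
`x` of `β_ρ + S + ℤ(A ∩ ρ)` lies in the Zariski closure of the exit points of `S` obtained by moving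
`x - β_ρ` far in the directions of the face `ρ`. -/
theorem eval_eq_zero_of_mem_exitSet_dualSet [CharZero K] {A : Finset (Fin d → ℤ)}
    {S : Set (Fin d → ℤ)} (hNA : IsNASet A S) {m : ℕ} {τ : Fin m → Set (Fin d → ℝ)}
    {β : Set (Fin d → ℝ) → Fin d → ℤ} (hβ : ∀ ρ ∈ tildeF A τ, β ρ ∈ latticePointsOfSpan K A ρ)
    {a : Fin d → ℤ} {p : MvPolynomial (Fin d) K}
    (hp : ∀ x ∈ exitSet S a, MvPolynomial.eval (toField K x) p = 0) {x : Fin d → ℤ}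
    (hx : x ∈ exitSet (dualSet A S τ β) a) : MvPolynomial.eval (toField K x) p = 0 := by
  obtain ⟨⟨ρ, hρ, s, hs, z, hz, hsz⟩, hxa⟩ := hx
  obtain ⟨c, hc, hzc⟩ := exists_add_mem_closure_of_mem_addSubgroupClosure hz
  have hcZ := closure_generatorsIn_le_latticeOf A ρ hc
  have hexit {e : Fin d → ℤ} (he : e ∈ AddSubmonoid.closure (generatorsIn A ρ)) :
      s + z + c + e ∈ exitSet S a := by
    constructor
    · rw [add_assoc s, add_assoc s]
      exact hNA.add_mem hs (add_mem hzc he)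
    · intro hmem
      have heZ := closure_generatorsIn_le_latticeOf A ρ he
      refine hxa ⟨ρ, hρ, _, hmem, -(c + e), neg_mem (add_mem hcZ heZ), ?_⟩
      have h1 : s + z = x - β ρ := hsz
      dsimp only
      rw [h1]
      abel
  have key := p.eval_add_eq_zero_of_mem_span (generatorsIn A ρ)
    (w := toField K (β ρ) - toField K c) (sub_mem (hβ ρ hρ) (toField_mem_span hc))
    (toField K (s + z + c)) (fun e he => by rw [← toField_add]; exact hp _ (hexit he))
  have h1 : s + z = x - β ρ := hsz
  rw [← key, h1]
  congr 2
  ext j; simp [toField]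

/-- Let `x` be an exit point of `S` and `ρ₀ ∈ F̃`. If the coset `x + a + β_ρ₀ + ℤ(A ∩ ρ₀)` misses
`β_ρ + S + ℤ(A ∩ ρ)` for each `ρ ⊇ ρ₀`, then a polynomial vanishing on the exit points of the dual
set vanishes at `x`: the points of `x + β_ρ₀ + ℤ(A ∩ ρ₀)` far enough in the direction opposite to
`ρ₀` are exit points of the dual set. -/
theorem eval_eq_zero_of_forall_superface [CharZero K] {A : Finset (Fin d → ℤ)}
    {S Sc : Set (Fin d → ℤ)} (hSc : IsFGNASet A Sc) (hS : S ⊆ Sc) {m : ℕ}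
    {τ : Fin m → Set (Fin d → ℝ)} (hτ : ∀ ρ ∈ tildeF A τ, IsConeFace A ρ)
    {β : Set (Fin d → ℝ) → Fin d → ℤ} {a : Fin d → ℤ} {p : MvPolynomial (Fin d) K}
    (hp : ∀ x ∈ exitSet (dualSet A S τ β) a, MvPolynomial.eval (toField K x) p = 0)
    {x : Fin d → ℤ} (hx : x ∈ S) {ρ₀ : Set (Fin d → ℝ)} (hρ₀ : ρ₀ ∈ tildeF A τ)
    (hβ : β ρ₀ ∈ latticePointsOfSpan K A ρ₀)
    (h : ∀ ρ ∈ tildeF A τ, ρ₀ ⊆ ρ → ∀ z ∈ latticeOf A ρ₀,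
      x + a + β ρ₀ + z - β ρ ∉ S + (latticeOf A ρ : Set (Fin d → ℤ))) :
    MvPolynomial.eval (toField K x) p = 0 := by
  set M := AddSubmonoid.closure (generatorsIn A ρ₀)
  have hMZ {c : Fin d → ℤ} (hc : c ∈ M) : c ∈ latticeOf A ρ₀ :=
    closure_generatorsIn_le_latticeOf A ρ₀ hc
  obtain ⟨c, hc, hcM⟩ := M.exists_forall_mem_of_finite
    ((finite_setOf_isConeFace A).subset hτ)
    (Q := fun ρ e => x + a + β ρ₀ - e - β ρ ∉ S + (latticeOf A ρ : Set (Fin d → ℤ)))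
    (fun ρ hρ => by
      by_cases hsub : ρ₀ ⊆ ρ
      · refine ⟨0, M.zero_mem, fun e he => ?_⟩
        have h1 := h ρ hρ hsub (-e) (neg_mem (hMZ he))
        rwa [zero_add, sub_eq_add_neg _ e]
      · obtain ⟨c, hc, hcM⟩ := exists_sub_notMem_add_latticeOf hSc hS (hτ _ hρ₀) (hτ ρ hρ) hsub
          (x + a + β ρ₀ - β ρ)
        refine ⟨c, hc, fun e he => ?_⟩
        have h1 := hcM e he
        rwa [sub_right_comm])
  have hexit {e : Fin d → ℤ} (he : e ∈ M) :
      x + β ρ₀ - (c + e) ∈ exitSet (dualSet A S τ β) a := by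
    refine ⟨⟨ρ₀, hρ₀, x, hx, -(c + e), neg_mem (hMZ (add_mem hc he)), by dsimp only; abel⟩, ?_⟩
    rintro ⟨ρ, hρ, hmem⟩
    refine hcM e he ρ hρ ?_
    convert hmem using 1
    abel
  have key := (negVars p).eval_add_eq_zero_of_mem_span (generatorsIn A ρ₀)
    (w := toField K (β ρ₀) - toField K c) (sub_mem hβ (toField_mem_span hc))
    (-toField K (x + β ρ₀ - c)) (fun e he => by
      rw [eval_negVars, ← hp _ (hexit he)]
      congr 2
      ext j; simp [toField]; ring)
  rw [eval_negVars] at key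
  rw [← key]
  congr 2
  ext j; simp [toField]

theorem IsStandardExpression.isConeFace {A : Finset (Fin d → ℤ)} {Sc S : Set (Fin d → ℤ)} {m : ℕ}
    {b : Fin m → Fin d → ℤ} {τ : Fin m → Set (Fin d → ℝ)}
    (hS : IsStandardExpression A Sc S b τ) {ρ : Set (Fin d → ℝ)} (hρ : ρ ∈ tildeF A τ) :
    IsConeFace A ρ := by
  rcases hρ with hρ | ⟨i, rfl⟩
  · exact hρ.1
  · exact hS.face i

theorem IsStandardExpression.notMem_latticeCoset {A : Finset (Fin d → ℤ)}
    {Sc S : Set (Fin d → ℤ)} {m : ℕ} {b : Fin m → Fin d → ℤ} {τ : Fin m → Set (Fin d → ℝ)}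
    (hS : IsStandardExpression A Sc S b τ) {x : Fin d → ℤ} (hx : x ∈ S) (i : Fin m) :
    x - b i ∉ latticeOf A (τ i) := by
  rw [hS.eq] at hx
  exact fun h => hx.2 (Set.mem_iUnion.2 ⟨i, h⟩)

/-- All faces in `F̃` are proper when `S` is not empty. -/
theorem IsStandardExpression.ne_coneOf {A : Finset (Fin d → ℤ)}
    (hA : AddSubgroup.closure (A : Set (Fin d → ℤ)) = ⊤) {Sc S : Set (Fin d → ℤ)} {m : ℕ}
    {b : Fin m → Fin d → ℤ} {τ : Fin m → Set (Fin d → ℝ)}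
    (hS : IsStandardExpression A Sc S b τ) (hne : S.Nonempty) {ρ : Set (Fin d → ℝ)}
    (hρ : ρ ∈ tildeF A τ) : ρ ≠ coneOf A := by
  rcases hρ with hρ | ⟨i, rfl⟩
  · exact hρ.ne_coneOf hA
  · intro h
    obtain ⟨x, hx⟩ := hne
    refine hS.notMem_latticeCoset hx i ?_
    rw [h, latticeOf_coneOf hA]
    exact AddSubgroup.mem_top _

/-- A polynomial vanishing on `exitSet (dualSet A S τ β) a` vanishes on `exitSet S a`. An exit point
`x` of `S` has `x + a` either outside `Sc`, and then a facet form excludes `x + a`, or in one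
of the removed cosets, and then the compatibility conditions on `β` apply. -/
theorem eval_eq_zero_of_mem_exitSet [CharZero K] {A : Finset (Fin d → ℤ)}
    (hA : AddSubgroup.closure (A : Set (Fin d → ℤ)) = ⊤) {Sc S : Set (Fin d → ℤ)} {m : ℕ}
    {b : Fin m → Fin d → ℤ} {τ : Fin m → Set (Fin d → ℝ)}
    (hS : IsStandardExpression A Sc S b τ) {β : Set (Fin d → ℝ) → Fin d → ℤ}
    (hβ : β ∈ setB K A b τ) {a : Fin d → ℤ} {p : MvPolynomial (Fin d) K}
    (hp : ∀ x ∈ exitSet (dualSet A S τ β) a, MvPolynomial.eval (toField K x) p = 0)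
    {x : Fin d → ℤ} (hx : x ∈ exitSet S a) : MvPolynomial.eval (toField K x) p = 0 := by
  obtain ⟨hxS, hxa⟩ := hx
  have hsub : S ⊆ Sc := by rw [hS.eq]; exact Set.sdiff_subset
  by_cases hSc : x + a ∈ Sc
  · -- `x + a` lies in a removed coset.
    obtain ⟨i, hi⟩ : ∃ i, x + a - b i ∈ latticeOf A (τ i) := by
      by_contra! hn
      refine hxa ?_
      rw [hS.eq]
      refine ⟨hSc, fun h => ?_⟩
      obtain ⟨i, hi⟩ := Set.mem_iUnion.1 h
      exact hn i hi
    have hτi : τ i ∈ tildeF A τ := Or.inr ⟨i, rfl⟩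
    refine eval_eq_zero_of_forall_superface hS.fg hsub (fun ρ => hS.isConeFace) hp hxS hτi
      (hβ.1 _ hτi) fun ρ hρ hle z hz => ?_
    have hmono : latticeOf A (τ i) ≤ latticeOf A ρ :=
      AddSubgroup.closure_mono fun v hv => ⟨hv.1, hle hv.2⟩
    obtain ⟨j, rfl, hj⟩ := hβ.2 i ρ hρ hle
    rintro ⟨s, hs, y, hy, hsy⟩
    refine hS.notMem_latticeCoset hs j ?_
    have h1 := add_mem (add_mem (add_mem (hmono hi) (hmono hz)) hj) (neg_mem hy)
    have h2 : s = x + a + β (τ i) + z - β (τ j) - y := by rw [← hsy]; simp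
    convert h1 using 1
    rw [h2]
    abel
  · -- Some facet form takes a value on `x + a` which it does not take on `S`.
    obtain ⟨σ, F, hσ, hF, hval⟩ : ∃ σ F, IsConeFacet A σ ∧ IsPrimitiveSupport A σ F ∧
        F (toReal (x + a)) ∉ valueSet F Sc := by
      by_contra! hn
      refine hSc ?_
      rw [hS.scored]
      exact fun σ F hσ hF => hn σ F hσ hF
    have hσF : σ ∈ tildeF A τ := Or.inl hσ
    refine eval_eq_zero_of_forall_superface hS.fg hsub (fun ρ => hS.isConeFace) hp hxS hσF
      (hβ.1 _ hσF) fun ρ hρ hle z hz => ?_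
    obtain rfl := hσ.eq_of_subset (hS.isConeFace hρ) (hS.ne_coneOf hA ⟨x, hxS⟩ hρ) hle
    rintro ⟨s, hs, y, hy, hsy⟩
    refine hval ⟨s, hsub hs, ?_⟩
    have h1 := congr_arg (formOn F) hsy
    simp only [map_add, map_sub, formOn_eq_zero_of_mem_latticeOf hF.2.1 hy,
      formOn_eq_zero_of_mem_latticeOf hF.2.1 hz, add_zero, add_sub_cancel_right] at h1
    change formOn F s = formOn F (x + a)
    rw [h1, map_add]

end DualSet

/-! ### Rings of differential operators of subsets of the lattice -/

section Main

open AddMonoidAlgebra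

variable {K : Type*} [Field K] {d : ℕ}

theorem symbolOp_mem_ringD_iff (f : (Fin d → ℤ) →₀ MvPolynomial (Fin d) K)
    (S : Set (Fin d → ℤ)) :
    symbolOp f ∈ ringD K S ↔
      ∀ a, ∀ x ∈ exitSet S a, MvPolynomial.eval (toField K x) (f a) = 0 := by
  have h1 : symbolOp f ∈ ringD K S ↔
      ∀ g ∈ supported K K S, symbolOp f g ∈ supported K K S :=
    ⟨fun h => h.2, fun h => ⟨symbolOp_mem_diffOps f, h⟩⟩
  rw [h1, map_supported_iff]
  simp only [coeff_symbolOp]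
  constructor
  · rintro h a x ⟨hx, hxa⟩
    simpa using h x hx (x + a) hxa
  · intro h x hx c hc
    exact h (c - x) x ⟨hx, by rwa [add_sub_cancel]⟩

/-- `D(S)` and the ring `D` of the dual set coincide, since the exit sets of the two sets have the
same Zariski closures. -/
theorem ringD_dualSet [CharZero K] {A : Finset (Fin d → ℤ)}
    (hA : AddSubgroup.closure (A : Set (Fin d → ℤ)) = ⊤) {Sc S : Set (Fin d → ℤ)} {m : ℕ}
    {b : Fin m → Fin d → ℤ} {τ : Fin m → Set (Fin d → ℝ)}
    (hS : IsStandardExpression A Sc S b τ) (hNA : IsNASet A S)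
    {β : Set (Fin d → ℝ) → Fin d → ℤ} (hβ : β ∈ setB K A b τ) :
    ringD K (dualSet A S τ β) = ringD K S := by
  ext P
  by_cases hP : P ∈ diffOps K (Laurent K d) (Laurent K d)
  · obtain ⟨f, rfl⟩ := exists_symbolOp_of_mem_diffOps hP
    rw [symbolOp_mem_ringD_iff, symbolOp_mem_ringD_iff]
    exact forall_congr' fun a =>
      ⟨fun h x hx => eval_eq_zero_of_mem_exitSet hA hS hβ h hx,
        fun h x hx => eval_eq_zero_of_mem_exitSet_dualSet hNA hβ.1 h hx⟩
  · exact iff_of_false (fun h => hP h.1) fun h => hP h.1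

/-- Formal adjoints exchange the operators preserving `K[S]` with those preserving `K[T]` if
`T` is the complement of `-S`. -/
theorem IsFormalAdjoint.mem_ringD_iff [CharZero K] {P Q : Module.End K (Laurent K d)}
    (h : IsFormalAdjoint P Q) {S T : Set (Fin d → ℤ)} (hT : ∀ a, a ∈ T ↔ -a ∉ S) :
    Q ∈ ringD K T ↔ P ∈ ringD K S := by
  have h1 : Q ∈ ringD K T ↔ ∀ g ∈ supported K K T, Q g ∈ supported K K T :=
    ⟨fun h => h.2, fun h' => ⟨h.mem_diffOps, h'⟩⟩
  have h2 : P ∈ ringD K S ↔ ∀ g ∈ supported K K S, P g ∈ supported K K S :=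
    ⟨fun h => h.2, fun h' => ⟨h.symm.mem_diffOps, h'⟩⟩
  rw [h1, h2, map_supported_iff, map_supported_iff]
  simp only [(isFormalAdjoint_iff.1 h).2]
  constructor
  · intro hQ b hb c hc
    exact hQ (-c) (by rwa [hT, neg_neg]) (-b) (by rwa [hT, neg_neg, not_not])
  · intro hP b hb c hc
    have := hP (-c) (by rwa [hT, not_not] at hc) (-b) (by rwa [hT] at hb)
    rwa [neg_neg, neg_neg] at this

/-- If formal adjoints exchange two subalgebras of differential operators, they define an
anti-isomorphism between them. -/
theorem exists_algEquiv_isFormalAdjoint [CharZero K]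
    {D D' : Subalgebra K (Module.End K (Laurent K d))}
    (hD : D ≤ diffOps K (Laurent K d) (Laurent K d))
    (hD' : D' ≤ diffOps K (Laurent K d) (Laurent K d))
    (h : ∀ P Q, IsFormalAdjoint P Q → (Q ∈ D' ↔ P ∈ D)) :
    ∃ φ : D ≃ₐ[K] D'ᵐᵒᵖ,
      ∀ P : D, IsFormalAdjoint (P : Module.End K (Laurent K d)) (φ P).unop := by
  choose adj hadj using fun P : D => exists_isFormalAdjoint (hD P.2)
  let φ : D →ₐ[K] D'ᵐᵒᵖ :=
    { toFun := fun P => MulOpposite.op ⟨adj P, (h _ _ (hadj P)).2 P.2⟩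
      map_one' := MulOpposite.unop_injective <| Subtype.ext <|
        (hadj 1).unique (by simpa using IsFormalAdjoint.algebraMap (d := d) (1 : K))
      map_mul' := fun P P' => MulOpposite.unop_injective <| Subtype.ext <|
        (hadj (P * P')).unique ((hadj P).mul (hadj P'))
      map_zero' := MulOpposite.unop_injective <| Subtype.ext <|
        (hadj 0).unique (by simpa using IsFormalAdjoint.algebraMap (d := d) (0 : K))
      map_add' := fun P P' => MulOpposite.unop_injective <| Subtype.ext <|
        (hadj (P + P')).unique ((hadj P).add (hadj P'))
      commutes' := fun r => MulOpposite.unop_injective <| Subtype.ext <|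
        (hadj (algebraMap K D r)).unique (IsFormalAdjoint.algebraMap r) }
  refine ⟨AlgEquiv.ofBijective φ ⟨fun P P' hPP => Subtype.ext ?_, fun Q => ?_⟩, hadj⟩
  · have h1 : adj P = adj P' := congr_arg (fun Q => (Q.unop : Module.End K (Laurent K d))) hPP
    exact (hadj P).symm.unique (h1 ▸ (hadj P').symm)
  · obtain ⟨P, hP⟩ := exists_isFormalAdjoint (hD' Q.unop.2)
    refine ⟨⟨P, (h _ _ hP.symm).1 Q.unop.2⟩, MulOpposite.unop_injective <| Subtype.ext ?_⟩
    exact (hadj _).unique hP.symm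

end Main

theorem mainTheorem3 {K : Type*} [Field K] [IsAlgClosed K] [CharZero K] {d : ℕ}
    (A : Finset (Fin d → ℤ))
    (hA : AddSubgroup.closure (A : Set (Fin d → ℤ)) = ⊤)
    (hconvex : ∀ x, x ∈ coneOf A → -x ∈ coneOf A → x = 0)
    (Sc S : Set (Fin d → ℤ)) {m : ℕ} (b : Fin m → Fin d → ℤ) (τ : Fin m → Set (Fin d → ℝ))
    (hS : IsStandardExpression A Sc S b τ) (hNA : IsNASet A S)
    (β : Set (Fin d → ℝ) → Fin d → ℤ) (hβ : β ∈ setB K A b τ) :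
    (ringD K (omegaSet A S τ β) : Set (Module.End K (Laurent K d)))
        = formalAdjoints (ringD K S : Set (Module.End K (Laurent K d))) ∧
    ∃ φ : ringD K S ≃ₐ[K] (ringD K (omegaSet A S τ β))ᵐᵒᵖ,
      ∀ P : ringD K S, IsFormalAdjoint (P : Module.End K (Laurent K d))
        (φ P).unop := by
  have hω (a : Fin d → ℤ) : a ∈ omegaSet A S τ β ↔ -a ∉ dualSet A S τ β := by
    simp [omegaSet, dualSet]
  have h (P Q : Module.End K (Laurent K d)) (hPQ : IsFormalAdjoint P Q) :
      Q ∈ ringD K (omegaSet A S τ β) ↔ P ∈ ringD K S := by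
    rw [hPQ.mem_ringD_iff hω, ringD_dualSet hA hS hNA hβ]
  refine ⟨Set.ext fun Q => ⟨fun hQ => ?_, ?_⟩,
    exists_algEquiv_isFormalAdjoint (fun P hP => hP.1) (fun Q hQ => hQ.1) h⟩
  · obtain ⟨P, hP⟩ := exists_isFormalAdjoint hQ.1
    exact ⟨P, (h _ _ hP.symm).1 hQ, hP.symm⟩
  · rintro ⟨P, hP, hPQ⟩
    exact (h _ _ hPQ).2 hP
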